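/- A JB$^*$-triple is a complex Banach space $E$ with a continuous triple product $\{a,b,c\}$, linear and symmetric in $a,c$ and conjugate linear in $b$, such that, with $L(a,b)x=\{a,b,x\}$: (1) $L(a,b)L(c,d)-L(c,d)L(a,b)=L(L(a,b)c,d)-L(c,L(b,a)d)$ for all $a,b,c,d\in E$; (2) $L(a,a)$ is a Hermitian operator with non-negative spectrum for every $a\in E$; (3) $\|\{a,a,a\}\|=\|a\|^3$ for every $a\in E$. An element $u$ is a tripotent if $\{u,u,u\}=u$. For a tripotent $u$, let $P_2(u)=L(u,u)(2L(u,u)-\mathrm{id})$ and $P_0(u)=(\mathrm{id}-L(u,u))(\mathrm{id}-2L(u,u))$, and let $E_2(u)=\{x: L(u,u)x=x\}$, which is the range of $P_2(u)$. A non-zero tripotent $u$ is minimal if $E_2(u)=\mathbb{C}u$; then $\phi_u:E\to\mathbb{C}$ is the continuous linear functional determined by $P_2(u)(x)=\phi_u(x)u$. Let $Q(u)x=\{u,x,u\}$ and $E^k(u)=\{x: Q(u)x=kx\}$ for $k\in\{-1,0,1\}$; then $E=E^{-1}(u)\oplus E^0(u)\oplus E^1(u)$, and $P^1(u)=\tfrac12(Q(u)^2+Q(u))$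 is the corresponding (real-linear) projection onto $E^1(u)$. **Proposition.** Let $u$ and $v$ be minimal tripotents in a JB$^*$-triple $E$. Then $P^1(u)(v)=\operatorname{Re}\phi_u(v)\,u$, one has $(1-\operatorname{Re}\phi_u(v))^2\ge\|P_0(u)(v)\|^2$, and $$\|u-v\|^2=(1-\operatorname{Re}\phi_u(v))+\sqrt{(1-\operatorname{Re}\phi_u(v))^2-\|P_0(u)(v)\|^2}.$$ (Thus, identifying $P^1(u)(v)$ with its real coefficient along $u$, $\operatorname{Re}\phi_u(v)$ may be replaced by $P^1(u)(v)$ in the formula.) -/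

import Mathlib

open scoped ComplexConjugate

/-- A continuous triple product on a complex normed space `E`: linear and symmetric in the outer
variables, conjugate linear in the middle one, and jointly continuous. -/
class ContinuousTripleProduct (E : Type*) [NormedAddCommGroup E] [NormedSpace ℂ E] where
  tp : E → E → E → E
  tp_add_left : ∀ a a' b c, tp (a + a') b c = tp a b c + tp a' b c
  tp_smul_left : ∀ (r : ℂ) (a b c : E), tp (r • a) b c = r • tp a b c
  tp_add_middle : ∀ a b b' c, tp a (b + b') c = tp a b c + tp a b' c
  tp_smul_middle : ∀ (r : ℂ) (a b c : E), tp a (r • b) c = conj r • tp a b c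
  tp_symm : ∀ a b c, tp a b c = tp c b a
  tp_continuous : Continuous fun p : E × E × E => tp p.1 p.2.1 p.2.2

namespace JBTriple

/-- A bounded operator `T` on a complex Banach space is Hermitian if `exp (i t T)` is an isometry
for every real `t` (equivalently, its numerical range is real). -/
def IsHermitianOp {E : Type*} [NormedAddCommGroup E] [NormedSpace ℂ E] (T : E →L[ℂ] E) : Prop :=
  ∀ t : ℝ, Isometry (NormedSpace.exp ((Complex.I * (t : ℂ)) • T) : E →L[ℂ] E)

section

variable {E : Type*} [NormedAddCommGroup E] [NormedSpace ℂ E] [ContinuousTripleProduct E]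

/-- The triple product `{a, b, c}`. -/
abbrev tp (a b c : E) : E := ContinuousTripleProduct.tp a b c

/-- The bounded operator `L(a,b) : x ↦ {a, b, x}`. -/
def L (a b : E) : E →L[ℂ] E where
  toFun x := tp a b x
  map_add' x y := by
    simp only [tp]
    rw [ContinuousTripleProduct.tp_symm, ContinuousTripleProduct.tp_add_left,
      ContinuousTripleProduct.tp_symm x, ContinuousTripleProduct.tp_symm y]
  map_smul' r x := by
    simp only [tp, RingHom.id_apply]
    rw [ContinuousTripleProduct.tp_symm, ContinuousTripleProduct.tp_smul_left,
      ContinuousTripleProduct.tp_symm x]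
  cont := ContinuousTripleProduct.tp_continuous.comp
    (continuous_const.prodMk (continuous_const.prodMk continuous_id))

@[simp] theorem L_apply (a b x : E) : L a b x = tp a b x := rfl

end

end JBTriple

/-- JB*-triples: complex Banach spaces with a continuous triple product satisfying the Jordan
identity, positivity of the operators `L(a,a)`, and the norm axiom `‖{a,a,a}‖ = ‖a‖³`. -/
class JBStarTriple (E : Type*) [NormedAddCommGroup E] [NormedSpace ℂ E] [CompleteSpace E]
    extends ContinuousTripleProduct E where
  jordan : ∀ a b c d : E,
    (JBTriple.L a b).comp (JBTriple.L c d) - (JBTriple.L c d).comp (JBTriple.L a b) =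
      JBTriple.L (JBTriple.L a b c) d - JBTriple.L c (JBTriple.L b a d)
  hermitian : ∀ a : E, JBTriple.IsHermitianOp (JBTriple.L a a)
  spectrum_nonneg : ∀ (a : E), ∀ z ∈ spectrum ℂ (JBTriple.L a a), 0 ≤ z.re ∧ z.im = 0
  norm_tp_self : ∀ a : E, ‖JBTriple.tp a a a‖ = ‖a‖ ^ 3

namespace JBTriple

variable {E : Type*} [NormedAddCommGroup E] [NormedSpace ℂ E] [CompleteSpace E] [JBStarTriple E]

/-- `u` is a tripotent: `{u, u, u} = u`. -/
def IsTripotent (u : E) : Prop := tp u u u = u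

/-- The Peirce subspace `E_j(u)`: the eigenspace of `L(u,u)` for the eigenvalue `j/2`. -/
noncomputable def peirceSpace (u : E) (j : Fin 3) : Submodule ℂ E :=
  Module.End.eigenspace (L u u : E →ₗ[ℂ] E) (((j : ℕ) : ℂ) / 2)

/-- The Peirce-2 projection `P₂(u) = L(u,u)(2L(u,u) - id)`. -/
noncomputable def P₂ (u : E) : E →L[ℂ] E :=
  (L u u).comp ((2 : ℂ) • L u u - ContinuousLinearMap.id ℂ E)

/-- The Peirce-0 projection `P₀(u) = (id - L(u,u))(id - 2L(u,u))`. -/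
noncomputable def P₀ (u : E) : E →L[ℂ] E :=
  (ContinuousLinearMap.id ℂ E - L u u).comp (ContinuousLinearMap.id ℂ E - (2 : ℂ) • L u u)

/-- The conjugate linear operator `Q(u) : x ↦ {u, x, u}`. -/
def Q (u x : E) : E := tp u x u

/-- For a tripotent `u`, the projection `P¹(u)` of `E` onto `E¹(u) = {x | Q(u) x = x}` along the
other two summands of the decomposition `E = E⁻¹(u) ⊕ E⁰(u) ⊕ E¹(u)`, where
`Eᵏ(u) = {x | Q(u) x = k x}`. In terms of `Q(u)` it is `(Q(u)² + Q(u)) / 2`. -/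
noncomputable def realPeirceOne (u x : E) : E := (2⁻¹ : ℂ) • (Q u (Q u x) + Q u x)

/-- A minimal tripotent: a non-zero tripotent with `E₂(u) = ℂ u`. -/
structure IsMinimalTripotent (u : E) : Prop where
  ne_zero : u ≠ 0
  tripotent : IsTripotent u
  peirceSpace_two : peirceSpace u 2 = Submodule.span ℂ {u}

/-- The Jordan identity, elementwise. -/
theorem jordan_apply (a b c d e : E) :
    tp a b (tp c d e) = tp (tp a b c) d e - tp c (tp b a d) e + tp c d (tp a b e) := by
  have h := congrArg (fun T : E →L[ℂ] E => T e) (JBStarTriple.jordan a b c d)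
  simp only [sub_apply, ContinuousLinearMap.comp_apply, L_apply] at h
  rw [← h]
  abel

/-- `P₂(u)` takes its values in `E₂(u)`. -/
theorem P₂_mem_peirceSpace {u : E} (hu : IsTripotent u) (x : E) : P₂ u x ∈ peirceSpace u 2 := by
  have hsymm : ∀ a b c : E, tp a b c = tp c b a := ContinuousTripleProduct.tp_symm
  have hu' : tp u u u = u := hu
  have h1 : ∀ y : E, tp u u (tp u y u) = tp u y u := by
    intro y
    have e1 := jordan_apply u y u u u
    have e2 := jordan_apply u u u y u
    rw [hu', hsymm (tp u y u) u u, hsymm y u u] at e1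
    rw [hu'] at e2
    have e3 : (3 : ℂ) • tp u u (tp u y u) = (3 : ℂ) • tp u y u := by
      linear_combination (norm := module) (-1 : ℂ) • e1 + e2
    exact smul_right_injective E (by norm_num : (3 : ℂ) ≠ 0) e3
  have h2 : tp u (tp u x u) u = P₂ u x := by
    have e := jordan_apply x u u u u
    rw [hu', hsymm x u u, hsymm (tp u u x) u u] at e
    have hP : P₂ u x = (2 : ℂ) • tp u u (tp u u x) - tp u u x := by
      simp only [P₂, ContinuousLinearMap.comp_apply, sub_apply,
        smul_apply, ContinuousLinearMap.id_apply, map_sub, map_smul, L_apply]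
    rw [hP]
    linear_combination (norm := module) e
  rw [peirceSpace, Module.End.mem_eigenspace_iff]
  have h3 := h1 (tp u x u)
  rw [h2] at h3
  simpa using h3

/-- For a minimal tripotent `u`, the functional `φ_u` determined by `P₂(u)(x) = φ_u(x) u`. -/
noncomputable def phi {u : E} (hu : IsMinimalTripotent u) : E →L[ℂ] ℂ :=
  (ContinuousLinearEquiv.coord ℂ u hu.ne_zero).comp
    ((P₂ u).codRestrict (Submodule.span ℂ {u})
      (fun x => hu.peirceSpace_two ▸ P₂_mem_peirceSpace hu.tripotent x))

theorem P₂_eq_phi_smul {u : E} (hu : IsMinimalTripotent u) (x : E) :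
    P₂ u x = phi hu x • u := by
  have h := ContinuousLinearEquiv.toSpanNonzeroSingleton_coord ℂ hu.ne_zero
    ((P₂ u).codRestrict (Submodule.span ℂ {u})
      (fun x => hu.peirceSpace_two ▸ P₂_mem_peirceSpace hu.tripotent x) x)
  exact (congrArg Subtype.val h).symm

end JBTriple

/-! Put `x = u - v`, `w = P₀ v u - P₀ u v`, `σ = 1 - Re φ_u(v)`, `λ = ‖P₀ u v‖²`. By
`tp_sub_self_self` and `tp_sub_sub_P₀`, `{x,x,x} = 2σx - w` and `{x,x,w} = λx`, so when `x`, `w` are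
independent `L x x` acts on their span with characteristic polynomial `t² - 2σt + λ`. Its roots are
real because `L x x` has real spectrum, and `‖x‖²` is the larger one (`norm_sq_of_quadratic`).

The norm enters through `y = P₀ u v`: minimality of `v` makes `{y,y,y}` a multiple of `y`, whence
`φ_v(y) = ‖y‖²` (`phi_P₀_eq_norm_sq`). That a single `λ` serves both tripotents rests on the
symmetry `phi_tp_symm`. -/

namespace JBTriple

/-! ### Real-trilinearity of the triple product. -/

section Algebra

variable {E : Type*} [NormedAddCommGroup E] [NormedSpace ℂ E] [ContinuousTripleProduct E]

theorem tp_comm (a b c : E) : tp a b c = tp c b a := ContinuousTripleProduct.tp_symm a b c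

theorem tp_add_right (a b c d : E) : tp a b (c + d) = tp a b c + tp a b d :=
  map_add (L a b) c d

theorem tp_smul_right (r : ℂ) (a b c : E) : tp a b (r • c) = r • tp a b c :=
  map_smul (L a b) r c

theorem tp_sub_right (a b c d : E) : tp a b (c - d) = tp a b c - tp a b d :=
  map_sub (L a b) c d

theorem tp_zero_right (a b : E) : tp a b 0 = 0 := map_zero (L a b)

theorem tp_add_left (a b c d : E) : tp (a + b) c d = tp a c d + tp b c d :=
  ContinuousTripleProduct.tp_add_left a b c d

theorem tp_smul_left (r : ℂ) (a b c : E) : tp (r • a) b c = r • tp a b c :=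
  ContinuousTripleProduct.tp_smul_left r a b c

theorem tp_sub_left (a b c d : E) : tp (a - b) c d = tp a c d - tp b c d := by
  rw [tp_comm, tp_sub_right, tp_comm d, tp_comm d]

theorem tp_add_middle (a b c d : E) : tp a (b + c) d = tp a b d + tp a c d :=
  ContinuousTripleProduct.tp_add_middle a b c d

theorem tp_smul_middle (r : ℂ) (a b c : E) : tp a (r • b) c = conj r • tp a b c :=
  ContinuousTripleProduct.tp_smul_middle r a b c

theorem tp_sub_middle (a b c d : E) : tp a (b - c) d = tp a b d - tp a c d := by
  have h := tp_add_middle a (b - c) c d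
  rw [sub_add_cancel] at h
  rw [h, add_sub_cancel_right]

theorem tp_zero_middle (a c : E) : tp a 0 c = 0 := by
  simpa using tp_sub_middle a 0 0 c

theorem tp_zero_left (b c : E) : tp 0 b c = 0 := by
  rw [tp_comm, tp_zero_right]

end Algebra

/-! ### Consequences of the Jordan identity and of the spectral and norm axioms. -/

variable {E : Type*} [NormedAddCommGroup E] [NormedSpace ℂ E] [CompleteSpace E] [JBStarTriple E]

/-- The identity `Q(x) L(y,x) = L(x,y) Q(x)`. -/
theorem tp_tp_middle_eq (x y z : E) : tp x (tp y x z) x = tp x y (tp x z x) := by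
  have h1 := jordan_apply x y x z x
  have h2 := jordan_apply x z x y x
  rw [tp_comm (tp x y x) z x] at h1
  rw [tp_comm (tp x z x) y x, tp_comm z x y] at h2
  have h : (3 : ℂ) • tp x (tp y x z) x = (3 : ℂ) • tp x y (tp x z x) := by
    linear_combination (norm := module) h1 + (2 : ℂ) • h2
  exact smul_right_injective E (by norm_num : (3 : ℂ) ≠ 0) h

/-- Triple products shift eigenvalues of `L(x,x)`. -/
theorem tp_tp_of_eigen {x y z w : E} {α β γ : ℂ} (hy : tp x x y = α • y) (hz : tp x x z = β • z)
    (hw : tp x x w = γ • w) : tp x x (tp y z w) = (α - conj β + γ) • tp y z w := by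
  rw [jordan_apply, hy, hz, hw, tp_smul_left, tp_smul_middle, tp_smul_right]
  module

section Pair

/-! Products of two tripotents `u`, `v` that are multiples of themselves under each other's
quadratic operators. -/

variable {u v : E} {a γ ε : ℂ}

/-- In these names `p` stands for `tp u u v`. Such products, with `u` and `v` also exchanged, are
what evaluating `L (u - v) (u - v)` on Peirce components requires. -/
theorem tp_pair_vup (hu : tp u u u = u) (hvu : tp v u v = a • v) :
    tp v u (tp u u v) = (a / 2) • (tp u u v + v) := by
  have h := jordan_apply u u v u v
  rw [hvu, hu, hvu, tp_smul_right, tp_comm (tp u u v)] at h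
  linear_combination (norm := module) (-(1 / 2) : ℂ) • h

theorem tp_pair_vvp (hv : tp v v v = v) (hγ : tp v (tp u u v) v = γ • v) :
    tp v v (tp u u v) = (1 / 2 : ℂ) • (tp u u v + γ • v) := by
  have h := jordan_apply u u v v v
  rw [hv, hγ, tp_comm (tp u u v)] at h
  linear_combination (norm := module) (-(1 / 2) : ℂ) • h

theorem tp_pair_uvp (huv : tp u v u = a • u) (hε : tp u (tp v v u) u = ε • u) :
    tp u v (tp u u v) = (1 / 2 : ℂ) • (ε • u + a • tp u u v) := by
  have h := jordan_apply v u u v u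
  rw [huv, tp_smul_right, tp_comm u v v, hε, tp_comm v u u, tp_comm (tp u u v)] at h
  linear_combination (norm := module) (-(1 / 2) : ℂ) • h

theorem tp_pair_upv (huv : tp u v u = a • u) (hε : tp u (tp v v u) u = ε • u)
    (hu : tp u u u = u) :
    tp u (tp u u v) v = (1 / 2 : ℂ) • (tp v v u + a • tp u u v) := by
  have h := jordan_apply u v v u u
  have h1 := tp_pair_uvp huv hε
  have h2 := tp_pair_vvp hu hε
  rw [huv, tp_smul_right, tp_comm u v v, tp_comm v u u, tp_comm (tp v v u), h1, h2,
    tp_comm v (tp u u v) u] at h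
  linear_combination (norm := module) h

end Pair

theorem nonneg_of_tp_self_eq {x y : E} {r : ℂ} (hy : y ≠ 0) (h : tp x x y = r • y) :
    0 ≤ r.re ∧ r.im = 0 := by
  refine JBStarTriple.spectrum_nonneg x r ?_
  intro hr
  have hinj : (algebraMap ℂ (E →L[ℂ] E) r - L x x) y = 0 := by
    simp [Algebra.algebraMap_eq_smul_one, h]
  obtain ⟨w, hw⟩ := hr
  apply hy
  have : ((↑w⁻¹ : E →L[ℂ] E) * (w : E →L[ℂ] E)) y = 0 := by
    rw [mul_apply_eq_comp, hw, hinj, map_zero]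
  simpa using this

theorem norm_sq_of_tp_self_eq {x : E} {r : ℂ} (hx : x ≠ 0) (h : tp x x x = r • x) :
    r = ((‖x‖ ^ 2 : ℝ) : ℂ) := by
  obtain ⟨h1, h2⟩ := nonneg_of_tp_self_eq hx h
  have h3 := JBStarTriple.norm_tp_self x
  have hr : r = (r.re : ℂ) := by apply Complex.ext <;> simp [h2]
  have hx' : ‖x‖ ≠ 0 := norm_ne_zero_iff.mpr hx
  rw [h, norm_smul, hr, Complex.norm_real, Real.norm_of_nonneg h1] at h3
  have h4 : r.re = ‖x‖ ^ 2 := by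
    apply mul_right_cancel₀ hx'
    rw [h3]; ring
  rw [hr, h4]

/-! ### Peirce calculus of one minimal tripotent. -/

variable {u v : E}

theorem P₂_apply (u x : E) : P₂ u x = (2 : ℂ) • tp u u (tp u u x) - tp u u x := by
  simp only [P₂, ContinuousLinearMap.comp_apply, sub_apply,
    smul_apply, ContinuousLinearMap.id_apply, map_sub, map_smul, L_apply]

theorem tp_tp_eq_phi (hu : IsMinimalTripotent u) (x : E) :
    tp u u (tp u u x) = (1 / 2 : ℂ) • (tp u u x + phi hu x • u) := by
  have h := P₂_eq_phi_smul hu x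
  rw [P₂_apply] at h
  linear_combination (norm := module) (1 / 2 : ℂ) • h

theorem P₀_apply (hu : IsMinimalTripotent u) (x : E) :
    P₀ u x = x - (2 : ℂ) • tp u u x + phi hu x • u := by
  have h := tp_tp_eq_phi hu x
  simp only [P₀, ContinuousLinearMap.comp_apply, sub_apply,
    smul_apply, ContinuousLinearMap.id_apply, map_sub, map_smul, L_apply]
  rw [h]
  module

theorem tp_P₀ (hu : IsMinimalTripotent u) (x : E) : tp u u (P₀ u x) = 0 := by
  have hu' : tp u u u = u := hu.tripotent
  rw [P₀_apply hu, tp_add_right, tp_sub_right, tp_smul_right, tp_smul_right,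
    tp_tp_eq_phi hu, hu']
  module

/-- `Q u` maps into `E₂(u) = ℂ u`, and its square is `P₂ u`; conjugate linearity then fixes the
coefficient. -/
theorem tp_mid_eq_phi (hu : IsMinimalTripotent u) (x : E) :
    tp u x u = conj (phi hu x) • u := by
  have hu' : tp u u u = u := hu.tripotent
  have h2 : tp u (tp u x u) u = phi hu x • u := by
    have e := jordan_apply x u u u u
    rw [hu', tp_comm x u u, tp_comm (tp u u x) u u] at e
    rw [tp_tp_eq_phi hu x] at e
    linear_combination (norm := module) e
  have h3 : tp u u (tp u x u) = tp u x u := by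
    have e1 := jordan_apply u x u u u
    have e2 := jordan_apply u u u x u
    rw [hu', tp_comm (tp u x u) u u, tp_comm x u u] at e1
    rw [hu'] at e2
    have e3 : (3 : ℂ) • tp u u (tp u x u) = (3 : ℂ) • tp u x u := by
      linear_combination (norm := module) (-1 : ℂ) • e1 + e2
    exact smul_right_injective E (by norm_num : (3 : ℂ) ≠ 0) e3
  have h4 : tp u x u ∈ peirceSpace u 2 := by
    rw [peirceSpace, Module.End.mem_eigenspace_iff]
    simpa using h3
  rw [hu.peirceSpace_two, Submodule.mem_span_singleton] at h4
  obtain ⟨k, hk⟩ := h4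
  rw [← hk, tp_smul_middle, hu'] at h2
  have h5 : conj k = phi hu x := smul_left_injective ℂ hu.ne_zero h2
  rw [← hk, ← h5, Complex.conj_conj]

theorem phi_of_tp_mid (hu : IsMinimalTripotent u) {x : E} {k : ℂ} (h : tp u x u = k • u) :
    phi hu x = conj k := by
  rw [tp_mid_eq_phi hu] at h
  have := smul_left_injective ℂ hu.ne_zero h
  rw [← this, Complex.conj_conj]

theorem phi_self (hu : IsMinimalTripotent u) : phi hu u = 1 := by
  have hu' : tp u u u = u := hu.tripotent
  rw [phi_of_tp_mid hu (k := 1) (by rw [hu', one_smul]), map_one]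

theorem phi_eq_zero_of_orth (hu : IsMinimalTripotent u) {y : E} (hy : tp u u y = 0) :
    phi hu y = 0 := by
  have h1 : phi hu y • u = 0 := by
    rw [← P₂_eq_phi_smul, P₂_apply, hy, tp_zero_right, smul_zero, sub_zero]
  exact (smul_eq_zero.mp h1).resolve_right hu.ne_zero

/-! ### Relations between two minimal tripotents. -/

theorem phi_eq_conj_of_ne_zero (hu : IsMinimalTripotent u) (hv : IsMinimalTripotent v)
    (h : phi hu v ≠ 0) : phi hv u = conj (phi hu v) := by
  have h1 := tp_tp_middle_eq u v v
  rw [tp_mid_eq_phi hu v, tp_mid_eq_phi hv u, tp_smul_middle, tp_smul_right, tp_mid_eq_phi hu v,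
    Complex.conj_conj, smul_smul, smul_smul] at h1
  have h2 := smul_left_injective ℂ hu.ne_zero h1
  exact mul_right_cancel₀ ((map_ne_zero _).mpr h) h2

theorem phi_symm (hu : IsMinimalTripotent u) (hv : IsMinimalTripotent v) :
    phi hv u = conj (phi hu v) := by
  by_cases h : phi hu v = 0
  · by_contra h'
    have h1 : phi hv u ≠ 0 := fun h1 => h' (by rw [h1, h, map_zero])
    have h2 := phi_eq_conj_of_ne_zero hv hu h1
    rw [h] at h2
    exact h1 ((map_eq_zero _).mp h2.symm)
  · exact phi_eq_conj_of_ne_zero hu hv h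

/-- The Peirce-0 space of a minimal tripotent is orthogonal to it. -/
theorem tp_eq_zero_of_orth (hu : IsMinimalTripotent u) {y : E} (hy : tp u u y = 0) (z : E) :
    tp u y z = 0 := by
  have hu' : tp u u u = u := hu.tripotent
  have h3 : tp u y u = 0 := by rw [tp_mid_eq_phi hu, phi_eq_zero_of_orth hu hy, map_zero, zero_smul]
  have e1 := jordan_apply u y u u z
  have e2 := jordan_apply u u u y z
  rw [h3, tp_comm y u u, hy, tp_zero_left, tp_zero_middle] at e1
  rw [hu', hy, tp_zero_middle] at e2
  linear_combination (norm := module) -e2 - e1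

theorem phi_P₀ (hu : IsMinimalTripotent u) (hv : IsMinimalTripotent v) :
    phi hv (P₀ u v) = 1 + phi hu v * conj (phi hu v) - 2 * phi hv (tp u u v) := by
  rw [P₀_apply hu, map_add, map_sub, map_smul, map_smul, phi_self hv, phi_symm hu hv]
  simp only [smul_eq_mul]
  ring

/-- Apply `P₀ u` to `{v,y,v} = conj φ_v(y) v` with `y = P₀ u v`. By Peirce arithmetic only `{y,y,y}`
survives on the left. -/
theorem tp_P₀_self (hu : IsMinimalTripotent u) (hv : IsMinimalTripotent v) :
    tp (P₀ u v) (P₀ u v) (P₀ u v) = conj (phi hv (P₀ u v)) • P₀ u v := by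
  have hu' : tp u u u = u := hu.tripotent
  have hy : tp u u (P₀ u v) = 0 := tp_P₀ hu v
  have horth := tp_eq_zero_of_orth hu hy
  set y := P₀ u v with hydef
  have hQ := tp_mid_eq_phi hv y
  set lam := conj (phi hv y) with hlam
  -- `z` is the Peirce-1 component of `v`.
  obtain ⟨z, hz, hvz⟩ : ∃ z, tp u u z = (1 / 2 : ℂ) • z ∧ v = phi hu v • u + z + y := by
    refine ⟨v - phi hu v • u - y, ?_, by abel⟩
    rw [hydef, P₀_apply hu]
    simp only [tp_sub_right, tp_add_right, tp_smul_right, hu', tp_tp_eq_phi hu]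
    module
  have hy0 : tp u u y = (0 : ℂ) • y := by rw [hy, zero_smul]
  have e1 := tp_tp_of_eigen hz hy0 hz
  have e2 := tp_tp_of_eigen hz hy0 hy0
  have e3 := tp_tp_of_eigen hy0 hy0 hy0
  have hexp : tp v y v = tp z y z + (2 : ℂ) • tp z y y + tp y y y := by
    conv_lhs => rw [hvz]
    simp only [tp_add_left, tp_add_right, tp_smul_left, tp_smul_right, horth,
      tp_comm z y u, tp_comm y y u, tp_comm y y z]
    module
  have hP : ∀ x : E, P₀ u x = x - (3 : ℂ) • tp u u x + (2 : ℂ) • tp u u (tp u u x) := by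
    intro x
    rw [P₀_apply hu, tp_tp_eq_phi hu]
    module
  have h1 : P₀ u (tp v y v) = tp y y y := by
    rw [hexp, map_add, map_add, map_smul, hP, hP, hP, e1, e2, e3]
    simp only [tp_smul_right, e1, e2, e3, map_zero]
    module
  rw [← h1, hQ, map_smul]

theorem phi_P₀_eq_norm_sq (hu : IsMinimalTripotent u) (hv : IsMinimalTripotent v) :
    phi hv (P₀ u v) = ((‖P₀ u v‖ ^ 2 : ℝ) : ℂ) := by
  by_cases h : P₀ u v = 0
  · simp [h]
  · have := norm_sq_of_tp_self_eq h (tp_P₀_self hu hv)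
    rw [← Complex.conj_conj (phi hv (P₀ u v)), this, Complex.conj_ofReal]

/-- The value `φ_v({u,u,v})` is real. -/
theorem conj_phi_tp (hu : IsMinimalTripotent u) (hv : IsMinimalTripotent v) :
    conj (phi hv (tp u u v)) = phi hv (tp u u v) := by
  have h := phi_P₀ hu hv
  rw [phi_P₀_eq_norm_sq hu hv] at h
  have h2 := congrArg conj h
  simp only [map_sub, map_add, map_mul, map_one, Complex.conj_ofReal, Complex.conj_conj,
    map_ofNat] at h2
  linear_combination (h2 - h) / 2

/-- The identity `Q(u) L(v,u) = L(u,v) Q(u)`, applied to `{v,v,u}`, yields the equality multiplied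
by `conj φ_u(v)`. -/
theorem phi_tp_eq_of_ne_zero (hu : IsMinimalTripotent u) (hv : IsMinimalTripotent v)
    (h : phi hu v ≠ 0) : phi hv (tp u u v) = phi hu (tp v v u) := by
  have hvv : tp v v v = v := hv.tripotent
  have hvu : tp v u v = phi hu v • v := by
    rw [tp_mid_eq_phi hv, phi_symm hu hv, Complex.conj_conj]
  have hc := tp_mid_eq_phi hv (tp u u v)
  have he := tp_mid_eq_phi hu (tp v v u)
  have huv := tp_mid_eq_phi hu v
  rw [conj_phi_tp hu hv] at hc
  rw [conj_phi_tp hv hu] at he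
  have h1 := tp_pair_uvp hvu hc
  have h2 := tp_tp_middle_eq u v (tp v v u)
  rw [h1, he, tp_smul_middle, tp_smul_right, tp_add_middle, tp_smul_middle, tp_smul_middle,
    huv, he] at h2
  simp only [smul_smul, ← add_smul] at h2
  have h3 := smul_left_injective ℂ hu.ne_zero h2
  have h4 : conj (phi hu v) ≠ 0 := (map_ne_zero _).mpr h
  simp only [conj_phi_tp hu hv, map_div₀, map_one, map_ofNat] at h3
  apply mul_right_cancel₀ h4
  linear_combination 2 * h3

/-- With `p = {u,u,v}`, the Jordan identity gives `{p,v,p} = ((c + e)/2) p`. Then `Q(v) L(p,v) =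
L(v,p) Q(v)` on `p` gives `c (c + e)/2 = c²`. -/
theorem phi_tp_mul_of_eq_zero (hu : IsMinimalTripotent u) (hv : IsMinimalTripotent v)
    (h : phi hu v = 0) :
    phi hv (tp u u v) * (phi hu (tp v v u) - phi hv (tp u u v)) = 0 := by
  have huu : tp u u u = u := hu.tripotent
  have hvv : tp v v v = v := hv.tripotent
  have hvu : tp v u v = (0 : ℂ) • v := by
    rw [tp_mid_eq_phi hv, phi_symm hu hv, Complex.conj_conj, h]
  have hc := tp_mid_eq_phi hv (tp u u v)
  have he := tp_mid_eq_phi hu (tp v v u)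
  have huv := tp_mid_eq_phi hu v
  rw [conj_phi_tp hu hv] at hc
  rw [conj_phi_tp hv hu] at he
  rw [h, map_zero] at huv
  have hcc := conj_phi_tp hu hv
  have hce := conj_phi_tp hv hu
  have huup := tp_tp_eq_phi hu v
  rw [h] at huup
  set c := phi hv (tp u u v)
  set e := phi hu (tp v v u)
  have h1 := tp_pair_uvp huv he
  have h2 := tp_pair_upv huv he huu
  have h3 := tp_pair_upv hvu hc hvv
  have h4 := tp_pair_vvp hvv hc
  have h5 := jordan_apply (tp u u v) v u u v
  rw [tp_comm (tp u u v) v u, h1, tp_comm v (tp u u v) u, h2, tp_comm (tp u u v) v v, h4] at h5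
  have h6 : tp (tp u u v) v (tp u u v) = ((c + e) / 2) • tp u u v := by
    rw [h5]
    simp only [tp_add_right, tp_smul_left, tp_smul_right, tp_smul_middle, zero_smul, add_zero,
      map_div₀, map_one, map_ofNat, tp_comm u (tp v v u) v,
      h3, huup]
    module
  have h7 := tp_tp_middle_eq v (tp u u v) (tp u u v)
  rw [h6, hc, tp_smul_middle, tp_smul_right, hc, smul_smul, smul_smul] at h7
  have h8 := smul_left_injective ℂ hv.ne_zero h7
  simp only [map_div₀, map_add, hcc, hce, map_ofNat] at h8
  linear_combination 2 * h8

theorem phi_tp_symm (hu : IsMinimalTripotent u) (hv : IsMinimalTripotent v) :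
    phi hv (tp u u v) = phi hu (tp v v u) := by
  by_cases h : phi hu v = 0
  · have h' : phi hv u = 0 := by rw [phi_symm hu hv, h, map_zero]
    rcases mul_eq_zero.mp (phi_tp_mul_of_eq_zero hu hv h) with h1 | h1
    · rcases mul_eq_zero.mp (phi_tp_mul_of_eq_zero hv hu h') with h2 | h2
      · rw [h1, h2]
      · exact sub_eq_zero.mp h2
    · exact (sub_eq_zero.mp h1).symm
  · exact phi_tp_eq_of_ne_zero hu hv h

theorem phi_P₀_symm (hu : IsMinimalTripotent u) (hv : IsMinimalTripotent v) :
    phi hv (P₀ u v) = phi hu (P₀ v u) := by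
  rw [phi_P₀ hu hv, phi_P₀ hv hu, phi_tp_symm hu hv, phi_symm hu hv, Complex.conj_conj]
  ring

theorem tp_sub_self_self (hu : IsMinimalTripotent u) (hv : IsMinimalTripotent v) :
    tp (u - v) (u - v) (u - v) =
      ((2 * (1 - (phi hu v).re) : ℝ) : ℂ) • (u - v) - (P₀ v u - P₀ u v) := by
  have huu : tp u u u = u := hu.tripotent
  have hvv : tp v v v = v := hv.tripotent
  have hre : ((2 * (1 - (phi hu v).re) : ℝ) : ℂ) = 2 - phi hu v - conj (phi hu v) := by
    apply Complex.ext <;> simp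
    ring
  rw [hre, P₀_apply hu, P₀_apply hv, phi_symm hu hv]
  simp only [tp_sub_left, tp_sub_right, tp_sub_middle, huu, hvv, tp_mid_eq_phi hu v,
    tp_mid_eq_phi hv u, phi_symm hu hv, Complex.conj_conj, tp_comm v u u, tp_comm u v v]
  module

theorem tp_sub_sub_P₀ (hu : IsMinimalTripotent u) (hv : IsMinimalTripotent v) :
    tp (u - v) (u - v) (P₀ v u - P₀ u v) = ((‖P₀ u v‖ ^ 2 : ℝ) : ℂ) • (u - v) := by
  rw [← phi_P₀_eq_norm_sq hu hv, phi_P₀ hu hv]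
  have huu : tp u u u = u := hu.tripotent
  have hvv : tp v v v = v := hv.tripotent
  have huv := tp_mid_eq_phi hu v
  have hvu : tp v u v = phi hu v • v := by
    rw [tp_mid_eq_phi hv, phi_symm hu hv, Complex.conj_conj]
  have hc := tp_mid_eq_phi hv (tp u u v)
  have he := tp_mid_eq_phi hu (tp v v u)
  rw [conj_phi_tp hu hv] at hc
  rw [conj_phi_tp hv hu, ← phi_tp_symm hu hv] at he
  have huup := tp_tp_eq_phi hu v
  have hvvq := tp_tp_eq_phi hv u
  rw [P₀_apply hu, P₀_apply hv]
  rw [phi_symm hu hv] at hvvq ⊢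
  simp only [tp_sub_left, tp_sub_right, tp_sub_middle, tp_add_right, tp_smul_right, huu, hvv,
    huv, hvu, tp_comm v u u, tp_comm u v v, huup, hvvq, tp_pair_vup huu hvu,
    tp_pair_vup hvv huv, tp_pair_vvp hvv hc, tp_pair_vvp huu he, tp_pair_uvp huv he,
    tp_pair_uvp hvu hc]
  module

theorem realPeirceOne_eq (hu : IsMinimalTripotent u) (x : E) :
    realPeirceOne u x = ((phi hu x).re : ℂ) • u := by
  have huu : tp u u u = u := hu.tripotent
  have hre : ((phi hu x).re : ℂ) = (1 / 2) * (phi hu x + conj (phi hu x)) := by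
    apply Complex.ext <;> simp
    ring
  rw [realPeirceOne, Q, Q, tp_mid_eq_phi hu x, tp_smul_middle, huu, Complex.conj_conj, hre]
  module

end JBTriple

/-! ### Hermitian operators on Jordan chains and eigenvectors. -/

namespace JBTriple

/-- `(T - r)²` kills `x`, so the exponential series of `c • (T - r)` at `x` stops after two terms.
-/
theorem exp_smul_apply {E : Type*} [NormedAddCommGroup E] [NormedSpace ℂ E] [CompleteSpace E]
    {T : E →L[ℂ] E} {x z : E} {r : ℂ} (hx : T x = r • x + z) (hz : T z = r • z) (c : ℂ) :
    (NormedSpace.exp (c • T) : E →L[ℂ] E) x = Complex.exp (c * r) • (x + c • z) := by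
  set A : E →L[ℂ] E := c • (T - algebraMap ℂ (E →L[ℂ] E) r) with hA
  have hdec : c • T = algebraMap ℂ (E →L[ℂ] E) (c * r) + A := by
    rw [hA, smul_sub, Algebra.algebraMap_eq_smul_one, Algebra.algebraMap_eq_smul_one, smul_smul]
    abel
  have hAx : A x = c • z := by
    simp [hA, Algebra.algebraMap_eq_smul_one, hx]
  have hAz : A z = 0 := by
    simp [hA, Algebra.algebraMap_eq_smul_one, hz]
  have hexpA : (NormedSpace.exp A : E →L[ℂ] E) x = x + c • z := by
    have h1 := (NormedSpace.exp_series_hasSum_exp' (𝕂 := ℂ) A).mapL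
      (ContinuousLinearMap.apply ℂ E x)
    have h2 : HasSum (fun n : ℕ => ((ContinuousLinearMap.apply ℂ E x)
        (((n.factorial : ℂ)⁻¹) • A ^ n))) (∑ n ∈ Finset.range 2,
          (ContinuousLinearMap.apply ℂ E x) (((n.factorial : ℂ)⁻¹) • A ^ n)) := by
      apply hasSum_sum_of_ne_finset_zero
      intro n hn
      obtain ⟨m, rfl⟩ : ∃ m, n = m + 2 := ⟨n - 2, by simp at hn; omega⟩
      simp [pow_add, pow_two, hAx, hAz]
    rw [Finset.sum_range_succ, Finset.sum_range_one] at h2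
    simpa [hAx] using h1.unique h2
  let _ : NormedAlgebra ℚ (E →L[ℂ] E) := NormedAlgebra.restrictScalars ℚ ℂ _
  rw [hdec, NormedSpace.exp_add_of_commute (Algebra.commutes _ _),
    ← NormedSpace.algebraMap_exp_comm, mul_apply_eq_comp, hexpA, ← Complex.exp_eq_exp_ℂ,
    Algebra.algebraMap_eq_smul_one]
  simp

/-- No nontrivial Jordan chain exists: it would make `exp (itT) x` grow linearly in `t`. -/
theorem eq_zero_of_isHermitianOp {E : Type*} [NormedAddCommGroup E] [NormedSpace ℂ E]
    [CompleteSpace E] {T : E →L[ℂ] E} (hT : IsHermitianOp T) {x z : E} {r : ℝ}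
    (hx : T x = (r : ℂ) • x + z) (hz : T z = (r : ℂ) • z) : z = 0 := by
  have key : ∀ t : ℝ, |t| * ‖z‖ ≤ 2 * ‖x‖ := by
    intro t
    have h1 := (hT t).norm_map_of_map_zero (map_zero _) x
    rw [exp_smul_apply hx hz, norm_smul, mul_assoc, ← Complex.ofReal_mul, mul_comm Complex.I,
      Complex.norm_exp_ofReal_mul_I, one_mul] at h1
    have h2 : ‖((t : ℂ) * Complex.I) • z‖ = |t| * ‖z‖ := by
      rw [norm_smul]; simp
    have h3 := norm_sub_le (x + ((t : ℂ) * Complex.I) • z) x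
    rw [add_sub_cancel_left, h2] at h3
    rw [mul_comm Complex.I] at h1
    linarith
  by_contra hne
  have hpos : 0 < ‖z‖ := norm_pos_iff.mpr hne
  have := key ((2 * ‖x‖ + 1) / ‖z‖)
  rw [abs_of_nonneg (by positivity), div_mul_cancel₀ _ hpos.ne'] at this
  linarith

/-- A Hermitian operator acts isometrically on the reflection exchanging two eigenspaces. -/
theorem norm_sub_eq_norm_add_of_isHermitianOp {E : Type*} [NormedAddCommGroup E]
    [NormedSpace ℂ E] [CompleteSpace E] {T : E →L[ℂ] E} (hT : IsHermitianOp T) {y z : E}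
    {r₁ r₂ : ℝ} (hne : r₁ ≠ r₂) (hy : T y = (r₁ : ℂ) • y) (hz : T z = (r₂ : ℂ) • z) :
    ‖y - z‖ = ‖y + z‖ := by
  have hd : (r₁ : ℂ) - r₂ ≠ 0 := by
    rw [← Complex.ofReal_sub]
    exact_mod_cast sub_ne_zero.mpr hne
  -- At this time the two eigenvectors acquire opposite phases.
  set t : ℝ := Real.pi / (r₁ - r₂) with ht
  have h1 := (hT t).norm_map_of_map_zero (map_zero _) (y + z)
  rw [map_add, exp_smul_apply (z := 0) (by rw [hy, add_zero]) (by simp),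
    exp_smul_apply (z := 0) (x := z) (by rw [hz, add_zero]) (by simp)] at h1
  have h2 : Complex.I * (t : ℂ) * r₁ = Complex.I * t * r₂ + Real.pi * Complex.I := by
    rw [ht]
    push_cast
    field_simp
    ring
  rw [h2, Complex.exp_add, Complex.exp_pi_mul_I] at h1
  simp only [smul_zero, add_zero] at h1
  rw [← h1, show (Complex.exp (Complex.I * t * r₂) * -1) • y + Complex.exp (Complex.I * t * r₂) • z
    = Complex.exp (Complex.I * t * r₂) • (z - y) by module, norm_smul, mul_assoc,
    ← Complex.ofReal_mul, mul_comm Complex.I, Complex.norm_exp_ofReal_mul_I, one_mul,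
    norm_sub_rev]

/-! ### The norm of a sum of two eigenvectors. -/

variable {E : Type*} [NormedAddCommGroup E] [NormedSpace ℂ E] [CompleteSpace E] [JBStarTriple E]

/-- `(T - β)(T - γ)` kills `y` and `z` but scales `x` by a nonzero factor; `β = γ` is allowed. -/
theorem eq_zero_of_eigen_add_eq_zero {F : Type*} [AddCommGroup F] [Module ℂ F] (T : F →ₗ[ℂ] F)
    {x y z : F} {α β γ : ℂ} (hx : T x = α • x) (hy : T y = β • y) (hz : T z = γ • z)
    (hβ : α - β ≠ 0) (hγ : α - γ ≠ 0) (h : x + y + z = 0) : x = 0 := by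
  have h1 : T (x + y + z) = 0 := by rw [h, map_zero]
  have h2 : T (T (x + y + z)) = 0 := by rw [h1, map_zero]
  simp only [map_add, hx, hy, hz, map_smul] at h1 h2
  have h3 : ((α - β) * (α - γ)) • x = 0 := by
    linear_combination (norm := module) h2 - (β + γ) • h1 + (β * γ) • h
  exact (smul_eq_zero.mp h3).resolve_left (mul_ne_zero hβ hγ)

/-- Expand `hy` and `hz` and compare eigencomponents: products of `y`, `z` have eigenvalues `r₁`,
`r₂`, `2r₁ - r₂`, `2r₂ - r₁`. -/
theorem tp_self_of_eigen {y z : E} {r₁ r₂ : ℝ} (hne : r₁ ≠ r₂)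
    (hy : tp (y + z) (y + z) y = (r₁ : ℂ) • y) (hz : tp (y + z) (y + z) z = (r₂ : ℂ) • z) :
    tp y y y = (r₁ : ℂ) • y := by
  have hd : (r₁ : ℂ) - r₂ ≠ 0 := by
    rw [← Complex.ofReal_sub]
    exact_mod_cast sub_ne_zero.mpr hne
  have heig := fun {a b c : E} {α β γ : ℂ} => tp_tp_of_eigen (x := y + z) (y := a) (z := b)
    (w := c) (α := α) (β := β) (γ := γ)
  have a1 := heig hy hy hy
  have a2 := heig hy hz hy
  have a3 := heig hz hy hy
  have a4 := heig hz hz hy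
  have b1 := heig hy hy hz
  have b2 := heig hz hy hz
  have b4 := heig hz hz hz
  simp only [Complex.conj_ofReal] at a1 a2 a3 a4 b1 b2 b4
  have hy' : tp y y y + tp y z y + tp z y y + tp z z y = (r₁ : ℂ) • y := by
    rw [← hy]
    simp only [tp_add_left, tp_add_middle]
    abel
  have hz' : tp y y z + tp z z y + tp z y z + tp z z z = (r₂ : ℂ) • z := by
    rw [← hz]
    simp only [tp_add_left, tp_add_middle, tp_comm z z y]
    abel
  have hT : ∀ w, (L (y + z) (y + z) : E →ₗ[ℂ] E) w = tp (y + z) (y + z) w := fun _ => rfl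
  have hzzy : tp z z y = 0 := by
    refine eq_zero_of_eigen_add_eq_zero (L (y + z) (y + z) : E →ₗ[ℂ] E) (α := r₁) (β := r₂)
      (γ := r₂ - r₁ + r₂) (y := tp y y z + tp z z z - (r₂ : ℂ) • z) (z := tp z y z)
      ?_ ?_ ?_ hd ?_ ?_
    · rw [hT, a4]; module
    · rw [hT, tp_sub_right, tp_add_right, tp_smul_right, b1, b4, hz]; module
    · rw [hT, b2]
    · rw [show (r₁ : ℂ) - (r₂ - r₁ + r₂) = 2 * (r₁ - r₂) by ring]
      exact mul_ne_zero two_ne_zero hd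
    · linear_combination (norm := module) hz'
  have hyyy : tp y y y + tp z z y - (r₁ : ℂ) • y = 0 := by
    refine eq_zero_of_eigen_add_eq_zero (L (y + z) (y + z) : E →ₗ[ℂ] E) (α := r₁) (β := r₂)
      (γ := r₁ - r₂ + r₁) (y := tp z y y) (z := tp y z y) ?_ ?_ ?_ hd ?_ ?_
    · rw [hT, tp_sub_right, tp_add_right, tp_smul_right, a1, a4, hy]; module
    · rw [hT, a3]; module
    · rw [hT, a2]
    · rw [show (r₁ : ℂ) - (r₁ - r₂ + r₁) = -(r₁ - r₂) by ring]
      exact neg_ne_zero.mpr hd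
    · linear_combination (norm := module) hy'
  rw [hzzy, add_zero] at hyyy
  exact sub_eq_zero.mp hyyy

/-- `‖y‖² = r₁` and the isometric reflection `z ↦ -z` give `‖y + z‖² ≥ r₁`. Conversely, `‖y + z‖³ =
‖r₁y + r₂z‖ ≤ r₁‖y + z‖`, by writing `r₁y + r₂z` as a nonnegative combination of `y + z` and `y -
z`. -/
theorem norm_sq_add_of_eigen {y z : E} {r₁ r₂ : ℝ} (hlt : r₂ < r₁) (hy0 : y ≠ 0)
    (hy : tp (y + z) (y + z) y = (r₁ : ℂ) • y) (hz : tp (y + z) (y + z) z = (r₂ : ℂ) • z) :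
    ‖y + z‖ ^ 2 = r₁ := by
  have hyyy := tp_self_of_eigen hlt.ne' hy hz
  have hr₁ : r₁ = ‖y‖ ^ 2 := by exact_mod_cast norm_sq_of_tp_self_eq hy0 hyyy
  by_cases hz0 : z = 0
  · rw [hz0, add_zero, hr₁]
  have hr₂ : 0 ≤ r₂ := by simpa using (nonneg_of_tp_self_eq hz0 hz).1
  have hrefl := norm_sub_eq_norm_add_of_isHermitianOp (JBStarTriple.hermitian (y + z)) hlt.ne'
    (y := y) (z := z) hy hz
  have hlow : ‖y‖ ≤ ‖y + z‖ := by
    have h1 := norm_add_le (y + z) (y - z)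
    rw [show y + z + (y - z) = (2 : ℂ) • y by module, norm_smul, hrefl, Complex.norm_two] at h1
    linarith
  have hup : ‖y + z‖ ^ 3 ≤ r₁ * ‖y + z‖ := by
    rw [← JBStarTriple.norm_tp_self]
    have h1 : tp (y + z) (y + z) (y + z) =
        (((r₁ + r₂) / 2 : ℝ) : ℂ) • (y + z) + (((r₁ - r₂) / 2 : ℝ) : ℂ) • (y - z) := by
      rw [tp_add_right, hy, hz]
      push_cast
      module
    rw [h1]
    refine (norm_add_le _ _).trans ?_
    rw [norm_smul, norm_smul, Complex.norm_real, Complex.norm_real, hrefl,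
      Real.norm_of_nonneg (by linarith), Real.norm_of_nonneg (by linarith)]
    apply le_of_eq
    ring
  have hpos : 0 < ‖y + z‖ := (norm_pos_iff.mpr hy0).trans_le hlow
  apply le_antisymm
  · apply le_of_mul_le_mul_right _ hpos
    calc ‖y + z‖ ^ 2 * ‖y + z‖ = ‖y + z‖ ^ 3 := by ring
      _ ≤ _ := hup
  · rw [hr₁]
    gcongr

/-- If `x`, `w` span a subspace on which `L(x,x)` has trace `2σ` and determinant `lam`, then `‖x‖²`
is the larger root of the characteristic polynomial. -/
theorem norm_sq_of_quadratic {x w : E} {σ lam : ℝ} (hx0 : x ≠ 0)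
    (hx : tp x x x = ((2 * σ : ℝ) : ℂ) • x - w) (hw : tp x x w = (lam : ℂ) • x)
    (hdep : ∀ k : ℝ, w = (k : ℂ) • x → lam = k * σ) :
    0 ≤ σ ^ 2 - lam ∧ ‖x‖ ^ 2 = σ + √(σ ^ 2 - lam) := by
  have heig : ∀ d : ℂ, d ^ 2 = σ ^ 2 - lam →
      tp x x ((σ + d) • x - w) = (σ + d) • ((σ + d) • x - w) := by
    intro d hd
    have h1 : (lam : ℂ) = (σ + d) * (σ - d) := by linear_combination hd
    rw [tp_sub_right, tp_smul_right, hx, hw, h1]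
    push_cast
    module
  have hself : ∀ d : ℂ, (σ + d) • x - w = 0 → tp x x x = (σ - d) • x := by
    intro d hd
    rw [hx, ← sub_eq_zero.mp hd]
    push_cast
    module
  have hdisc : 0 ≤ σ ^ 2 - lam := by
    obtain ⟨d, hd⟩ := IsAlgClosed.exists_pow_nat_eq ((σ : ℂ) ^ 2 - lam) (n := 2) (by norm_num)
    have him : d.im = 0 := by
      by_cases h : (σ + d) • x - w = 0
      · simpa using (nonneg_of_tp_self_eq hx0 (hself d h)).2
      · simpa using (nonneg_of_tp_self_eq h (heig d hd)).2
    have hre : d = (d.re : ℂ) := by apply Complex.ext <;> simp [him]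
    rw [hre] at hd
    have : d.re ^ 2 = σ ^ 2 - lam := by exact_mod_cast hd
    rw [← this]
    positivity
  refine ⟨hdisc, ?_⟩
  set δ := √(σ ^ 2 - lam) with hδ
  have hδ2 : δ ^ 2 = σ ^ 2 - lam := Real.sq_sqrt hdisc
  have hδ2' : (δ : ℂ) ^ 2 = (σ : ℂ) ^ 2 - lam := by exact_mod_cast hδ2
  rcases (Real.sqrt_nonneg (σ ^ 2 - lam)).eq_or_lt with h0 | hpos
  · rw [← hδ] at h0
    have hδ0 : (δ : ℂ) = 0 := by exact_mod_cast h0.symm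
    have h1 := heig 0 (by rw [← hδ2', hδ0])
    rw [add_zero] at h1
    have hz := eq_zero_of_isHermitianOp (JBStarTriple.hermitian x) (x := x) (r := σ)
      (by rw [L_apply, hx]; push_cast; module) h1
    have h2 := hself 0 (by rw [add_zero, hz])
    rw [sub_zero] at h2
    rw [← h0, add_zero]
    exact_mod_cast (norm_sq_of_tp_self_eq hx0 h2).symm
  · rw [← hδ] at hpos
    -- Otherwise `x` is an eigenvector for the smaller root only. Then `hdep` forces `(σ + δ)δ = 0`,
    -- against `σ ≥ δ > 0`.
    have hy0 : ((σ : ℂ) + δ) • x - w ≠ 0 := by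
      intro h
      have h1 : 0 ≤ σ - δ := by simpa using (nonneg_of_tp_self_eq hx0 (hself δ h)).1
      have h2 := hdep (σ + δ) (by push_cast; exact (sub_eq_zero.mp h).symm)
      nlinarith
    have hδne : (δ : ℂ) ≠ 0 := by exact_mod_cast hpos.ne'
    set y := ((2 * δ : ℂ)⁻¹) • (((σ : ℂ) + δ) • x - w) with hy
    set z := (-(2 * δ : ℂ)⁻¹) • (((σ : ℂ) + -δ) • x - w) with hz
    have hyz : y + z = x := by
      have h1 : y + z = ((2 * δ : ℂ)⁻¹ * (2 * δ)) • x := by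
        rw [hy, hz]
        module
      rw [h1, inv_mul_cancel₀ (by simpa using hδne), one_smul]
    have hTy : tp x x y = ((σ + δ : ℝ) : ℂ) • y := by
      rw [hy, tp_smul_right, heig _ hδ2', smul_comm]
      push_cast
      rfl
    have hTz : tp x x z = ((σ - δ : ℝ) : ℂ) • z := by
      rw [hz, tp_smul_right, heig _ (by rw [neg_sq, hδ2']), smul_comm]
      push_cast
      rw [← sub_eq_add_neg]
    have hyne : y ≠ 0 := smul_ne_zero (by simpa using hδne) hy0
    clear_value y z
    subst hyz
    exact norm_sq_add_of_eigen (by linarith) hyne hTy hTz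

end JBTriple

theorem proposition3p3 {E : Type*} [NormedAddCommGroup E] [NormedSpace ℂ E] [CompleteSpace E]
    [JBStarTriple E] (u v : E) (hu : JBTriple.IsMinimalTripotent u)
    (hv : JBTriple.IsMinimalTripotent v) :
    JBTriple.realPeirceOne u v = ((JBTriple.phi hu v).re : ℂ) • u ∧
    0 ≤ (1 - (JBTriple.phi hu v).re) ^ 2 - ‖JBTriple.P₀ u v‖ ^ 2 ∧
    ‖u - v‖ ^ 2 = (1 - (JBTriple.phi hu v).re) +
      Real.sqrt ((1 - (JBTriple.phi hu v).re) ^ 2 - ‖JBTriple.P₀ u v‖ ^ 2) := by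
  refine ⟨JBTriple.realPeirceOne_eq hu v, ?_⟩
  have hphi : JBTriple.phi hu u = 1 := JBTriple.phi_self hu
  by_cases h0 : u - v = 0
  · obtain rfl : u = v := sub_eq_zero.mp h0
    have h1 : JBTriple.P₀ u u = 0 := by
      have huu : JBTriple.tp u u u = u := hu.tripotent
      rw [JBTriple.P₀_apply hu, huu, hphi]
      module
    simp [h1, hphi]
  · refine JBTriple.norm_sq_of_quadratic h0 (JBTriple.tp_sub_self_self hu hv)
      (JBTriple.tp_sub_sub_P₀ hu hv) ?_
    intro k hk
    -- Applying `φ_u` to `w = kx` kills `P₀ u v` and leaves `λ = k(1 - φ_u(v))`; real parts give the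
    -- claim.
    have h1 := congrArg (JBTriple.phi hu) hk
    have h2 : JBTriple.phi hu (JBTriple.P₀ u v) = 0 :=
      JBTriple.phi_eq_zero_of_orth hu (JBTriple.tp_P₀ hu v)
    rw [map_sub, map_smul, map_sub, h2, hphi, sub_zero, ← JBTriple.phi_P₀_symm hu hv,
      JBTriple.phi_P₀_eq_norm_sq hu hv, smul_eq_mul] at h1
    simpa [-Complex.ofReal_pow] using congrArg Complex.re h1
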